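/- Let $d$ be a nonnegative integer, let $\mu_k<\nu_k$ ($1\le k\le d$) be real numbers, and put $[\mu,\nu]=\prod_{k=1}^d[\mu_k,\nu_k]\subset\mathbb R^d$. Let $h$ be a polynomial in $d$ variables with real or complex coefficients such that $h(t)\ne0$ for all $t\in[\mu,\nu]$. For $M\ge0$, $0\le i\le M$ and $1\le k\le d$ let $$x_{k,i}=\frac{\nu_k+\mu_k}{2}+\frac{\nu_k-\mu_k}{2}\cos\frac{(i+1/2)\pi}{M+1}$$ be the rescaled Chebyshev points of $[\mu_k,\nu_k]$, write $x_{\mathbf j}=(x_{1,j_1},\dots,x_{d,j_d})$ for $\mathbf j=(j_1,\dots,j_d)\in\{0,\dots,M\}^d$, and let $$C_M(t)=\sum_{\mathbf j\in\{0,\dots,M\}^d}\frac{1}{h(x_{\mathbf j})}\prod_{k=1}^d\ \prod_{0\le i\le M,\ i\ne j_k}\frac{t_k-x_{k,i}}{x_{k,j_k}-x_{k,i}}$$ be the tensor-product Chebyshev interpolation polynomial of $1/h$, of degree at most $M$ in each variable. Then there exist constants $D_1\in(0,\infty)$ and $r_1\in(0,1)$, independent of $M$, such that $$\sup_{t\in[\mu,\nu]}|1-h(t)C_M(t)|\le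 D_1r_1^M\qquad\text{for all integers } M\ge0.$$ -/

import Mathlib

namespace ChebyshevInterpolation

/-- The rescaled Chebyshev points `(ν + μ)/2 + (ν - μ)/2 * cos ((j + 1/2)π / (M + 1))`,
`0 ≤ j ≤ M`, of the interval `[μ, ν]`. -/
noncomputable def node (μ ν : ℝ) (M : ℕ) (j : Fin (M + 1)) : ℝ :=
  (ν + μ) / 2 + (ν - μ) / 2 * Real.cos (((j : ℝ) + 1 / 2) * Real.pi / ((M : ℝ) + 1))

/-- The rescaled Chebyshev points of the box `[μ, ν] = ∏ₖ [μₖ, νₖ]`, indexed by multi-indices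
`j = (j₁, …, j_d)` with `0 ≤ jₖ ≤ M`. -/
noncomputable def point {d : ℕ} (μ ν : Fin d → ℝ) (M : ℕ) (j : Fin d → Fin (M + 1)) :
    Fin d → ℝ :=
  fun k => node (μ k) (ν k) M (j k)

/-- The value at a real point `t` of a multivariate polynomial with coefficients in `𝕜`
(the real or the complex numbers). -/
noncomputable def evalReal {𝕜 : Type*} [RCLike 𝕜] {d : ℕ} (p : MvPolynomial (Fin d) 𝕜)
    (t : Fin d → ℝ) : 𝕜 :=
  MvPolynomial.eval (fun k => ((t k : ℝ) : 𝕜)) p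

/-- The tensor-product Lagrange basis polynomial at the rescaled Chebyshev points,
`∏ₖ ∏_{i ≠ jₖ} (tₖ - x_{k,i}) / (x_{k,jₖ} - x_{k,i})`, where `x_{k,i}` is the `i`-th Chebyshev
point of `[μₖ, νₖ]`. -/
noncomputable def lagrangeBasis (𝕜 : Type*) [RCLike 𝕜] {d : ℕ} (μ ν : Fin d → ℝ) (M : ℕ)
    (j : Fin d → Fin (M + 1)) : MvPolynomial (Fin d) 𝕜 :=
  ∏ k : Fin d, ∏ i ∈ Finset.univ.erase (j k),
    (MvPolynomial.X k - MvPolynomial.C ((node (μ k) (ν k) M i : ℝ) : 𝕜)) *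
      MvPolynomial.C (((node (μ k) (ν k) M (j k) - node (μ k) (ν k) M i)⁻¹ : ℝ) : 𝕜)

/-- The Chebyshev interpolation polynomial `C_M`, of degree at most `M` in each variable, of the
reciprocal `1 / h` on the box `[μ, ν]`. -/
noncomputable def interpolant {𝕜 : Type*} [RCLike 𝕜] {d : ℕ} (h : MvPolynomial (Fin d) 𝕜)
    (μ ν : Fin d → ℝ) (M : ℕ) : MvPolynomial (Fin d) 𝕜 :=
  ∑ j : Fin d → Fin (M + 1),
    MvPolynomial.C (1 / evalReal h (point μ ν M j)) * lagrangeBasis 𝕜 μ ν M j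

/-- The pointwise errors `|1 - h(t) C_M(t)|`, for `t` in the box `[μ, ν]`. -/
def errorSet {𝕜 : Type*} [RCLike 𝕜] {d : ℕ} (h : MvPolynomial (Fin d) 𝕜)
    (μ ν : Fin d → ℝ) (M : ℕ) : Set ℝ :=
  (fun t => ‖1 - evalReal h t * evalReal (interpolant h μ ν M) t‖) '' Set.Icc μ ν

/-- The uniform error `sup_{t ∈ [μ, ν]} |1 - h(t) C_M(t)|`. -/
noncomputable def uniformError {𝕜 : Type*} [RCLike 𝕜] {d : ℕ} (h : MvPolynomial (Fin d) 𝕜)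
    (μ ν : Fin d → ℝ) (M : ℕ) : ℝ :=
  sSup (errorSet h μ ν M)

end ChebyshevInterpolation

namespace ChebyshevInterpolation

/-! Interpolation reproduces every polynomial `p` of total degree at most `M`, so `p - C_M` is the
interpolant of `p - 1/h`. At Chebyshev points each one-variable Lagrange basis polynomial is at most
`M + 1` in absolute value, so interpolation amplifies errors by at most `(M + 1) ^ (2 * d)`. A crude
polynomial bound suffices once some `p` approximates `1/h` geometrically well.

Such a `p` needs no complex analysis: `1/h = conj h / |h|²`, and `1/|h|²` is a geometric series in
`1 - c|h|²`. For small `c` this ratio lies in `[0, q]` on the box with `q < 1`, and `N` terms leave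
exactly `1 - h p = (1 - c|h|²)^N`. Taking `N` proportional to `M` gives geometric decay, which
absorbs the polynomial factor. -/

theorem abs_sin_nat_mul_le (n : ℕ) (x : ℝ) : |Real.sin (n * x)| ≤ n * |Real.sin x| := by
  induction n with
  | zero => simp
  | succ n ih =>
    have e : Real.sin ((n + 1 : ℕ) * x)
        = Real.sin (n * x) * Real.cos x + Real.cos (n * x) * Real.sin x := by
      rw [← Real.sin_add]; push_cast; ring_nf
    rw [e]
    refine (abs_add_le _ _).trans ?_
    rw [abs_mul, abs_mul]
    have h1 := mul_le_of_le_one_right (abs_nonneg (Real.sin (n * x))) (Real.abs_cos_le_one x)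
    have h2 := mul_le_of_le_one_left (abs_nonneg (Real.sin x)) (Real.abs_cos_le_one (n * x))
    push_cast
    linarith

/-- A Lipschitz bound for `T_n` on `[-1, 1]` with Markov's constant `n²`: both differences of
cosines factor into two sines, each compared by the previous lemma. -/
theorem abs_cos_nat_mul_sub_le (n : ℕ) (a b : ℝ) :
    |Real.cos (n * a) - Real.cos (n * b)| ≤ (n : ℝ) ^ 2 * |Real.cos a - Real.cos b| := by
  rw [Real.cos_sub_cos, Real.cos_sub_cos, ← mul_add, ← mul_sub, mul_div_assoc, mul_div_assoc]
  simp only [abs_mul]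
  have := mul_le_mul (abs_sin_nat_mul_le n ((a + b) / 2)) (abs_sin_nat_mul_le n ((a - b) / 2))
    (abs_nonneg _) (by positivity)
  norm_num
  nlinarith

/-- The angle of the `j`-th Chebyshev point. -/
noncomputable def angle (M : ℕ) (j : Fin (M + 1)) : ℝ :=
  ((j : ℝ) + 1 / 2) * Real.pi / ((M : ℝ) + 1)

theorem angle_mem (M : ℕ) (j : Fin (M + 1)) : angle M j ∈ Set.Icc 0 Real.pi := by
  have hj : (j : ℝ) ≤ M := by exact_mod_cast Fin.is_le j
  have := Real.pi_pos
  refine ⟨by unfold angle; positivity, ?_⟩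
  unfold angle
  rw [div_le_iff₀ (by positivity)]
  nlinarith

theorem angle_injective (M : ℕ) : Function.Injective (angle M) := by
  intro i j hij
  unfold angle at hij
  have := Real.pi_pos
  field_simp at hij
  exact Fin.ext (by exact_mod_cast (by linarith : (i : ℝ) = j))

theorem cos_angle_injective (M : ℕ) : Function.Injective fun j => Real.cos (angle M j) :=
  fun i j hij => angle_injective M (Real.injOn_cos (angle_mem M i) (angle_mem M j) hij)

theorem node_eq (μ ν : ℝ) (M : ℕ) (j : Fin (M + 1)) :
    node μ ν M j = (ν + μ) / 2 + (ν - μ) / 2 * Real.cos (angle M j) := rfl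

theorem node_injective {μ ν : ℝ} (hμν : μ < ν) (M : ℕ) : Function.Injective (node μ ν M) := by
  intro i j hij
  rw [node_eq, node_eq] at hij
  have h0 : (ν - μ) / 2 ≠ 0 := by linarith
  exact cos_angle_injective M (mul_left_cancel₀ h0 (add_left_cancel hij))

theorem node_mem_Icc {μ ν : ℝ} (hμν : μ < ν) (M : ℕ) (j : Fin (M + 1)) :
    node μ ν M j ∈ Set.Icc μ ν := by
  rw [node_eq]
  constructor <;> nlinarith [Real.neg_one_le_cos (angle M j), Real.cos_le_one (angle M j)]

theorem nat_mul_angle (M : ℕ) (j : Fin (M + 1)) :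
    ((M + 1 : ℕ) : ℝ) * angle M j = Real.pi / 2 + (j : ℕ) * Real.pi := by
  unfold angle
  push_cast
  field_simp
  ring

theorem cos_nat_mul_angle (M : ℕ) (j : Fin (M + 1)) :
    Real.cos ((M + 1 : ℕ) * angle M j) = 0 := by
  rw [nat_mul_angle, Real.cos_add_nat_mul_pi]; simp

theorem abs_sin_nat_mul_angle (M : ℕ) (j : Fin (M + 1)) :
    |Real.sin ((M + 1 : ℕ) * angle M j)| = 1 := by
  rw [nat_mul_angle, Real.sin_add_nat_mul_pi]; simp

/-! ### One-variable Chebyshev interpolation -/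

open Polynomial in
/-- The Chebyshev polynomial `T_{M + 1}` is a multiple of the nodal polynomial of its zeros. -/
theorem T_eq_nodal (M : ℕ) : ∃ c : ℝ, Chebyshev.T ℝ ((M + 1 : ℕ) : ℤ)
    = C c * Lagrange.nodal Finset.univ fun j => Real.cos (angle M j) := by
  set y : Fin (M + 1) → ℝ := fun j => Real.cos (angle M j)
  set T := Chebyshev.T ℝ ((M + 1 : ℕ) : ℤ)
  have hroot (j) : T.eval (y j) = 0 := by
    have := Chebyshev.T_real_cos (angle M j) ((M + 1 : ℕ) : ℤ)
    rw [Int.cast_natCast, cos_nat_mul_angle] at this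
    exact this
  have hdvd : Lagrange.nodal Finset.univ y ∣ T := by
    rw [Lagrange.nodal]
    refine Finset.prod_dvd_of_coprime ?_ fun j _ => dvd_iff_isRoot.2 (hroot j)
    exact (pairwise_coprime_X_sub_C (cos_angle_injective M)).set_pairwise _
  obtain ⟨q, hq⟩ := hdvd
  have hdeg : T.natDegree = M + 1 := by
    exact (Chebyshev.natDegree_T ℝ _).trans (Int.natAbs_natCast _)
  have hq0 : q ≠ 0 := by
    rintro rfl
    rw [hq] at hdeg; simp at hdeg
  have := congrArg natDegree hq
  rw [natDegree_mul Lagrange.nodal_ne_zero hq0, hdeg, Lagrange.natDegree_nodal] at this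
  simp only [Finset.card_univ, Fintype.card_fin] at this
  refine ⟨q.coeff 0, ?_⟩
  rw [hq, mul_comm, eq_C_of_natDegree_eq_zero (by omega : q.natDegree = 0)]
  simp

-- With `n = M + 1`, the product is `T_n(s) / ((s - y_j) T_n'(y_j))`. As `T_n(y_j) = 0`, the
-- Lipschitz bound gives `|T_n(s) / (s - y_j)| ≤ n²`, while `|T_n'(y_j)| = n |U_M(y_j)| = n / |sin
-- θ_j| ≥ n`.
open Polynomial in
theorem abs_lagrange_cos_angle_le (M : ℕ) (j : Fin (M + 1)) {s : ℝ} (hs : s ∈ Set.Icc (-1) 1) :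
    |∏ i ∈ Finset.univ.erase j, (s - Real.cos (angle M i)) *
      (Real.cos (angle M j) - Real.cos (angle M i))⁻¹| ≤ M + 1 := by
  set y : Fin (M + 1) → ℝ := fun j => Real.cos (angle M j) with hy
  change |∏ i ∈ Finset.univ.erase j, (s - y i) * (y j - y i)⁻¹| ≤ M + 1
  have hne : ∀ i ∈ Finset.univ.erase j, y j - y i ≠ 0 := fun i hi =>
    sub_ne_zero.2 ((cos_angle_injective M).ne (Finset.ne_of_mem_erase hi).symm)
  -- The numerator bound comes from cancelling `|s - y j|`, so the node itself is treated apart.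
  rcases eq_or_ne s (y j) with rfl | hsj
  · rw [Finset.prod_eq_one fun i hi => mul_inv_cancel₀ (hne i hi)]
    simp
  obtain ⟨c, hc⟩ := T_eq_nodal M
  set n : ℝ := ((M + 1 : ℕ) : ℝ) with hn
  have hn1 : (1 : ℝ) ≤ n := by rw [hn]; push_cast; linarith [(Nat.cast_nonneg M : (0 : ℝ) ≤ M)]
  have hT (a : ℝ) : Real.cos (n * a) = c * ∏ i, (Real.cos a - y i) := by
    have := Chebyshev.T_real_cos a ((M + 1 : ℕ) : ℤ)
    rw [Int.cast_natCast, hc, eval_mul, eval_C, Lagrange.eval_nodal] at this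
    exact this.symm
  have hnum : |c * ∏ i ∈ Finset.univ.erase j, (s - y i)| ≤ n ^ 2 := by
    have h1 := abs_cos_nat_mul_sub_le (M + 1) (Real.arccos s) (angle M j)
    rw [cos_nat_mul_angle, sub_zero, hT, Real.cos_arccos hs.1 hs.2,
      ← Finset.mul_prod_erase _ _ (Finset.mem_univ j)] at h1
    have h2 : 0 < |s - y j| := abs_pos.2 (sub_ne_zero.2 hsj)
    refine le_of_mul_le_mul_right ?_ h2
    rw [← abs_mul, mul_assoc, mul_comm (∏ i ∈ Finset.univ.erase j, (s - y i))]
    exact h1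
  have hden : n ≤ |c * ∏ i ∈ Finset.univ.erase j, (y j - y i)| := by
    have hd : (derivative (Chebyshev.T ℝ ((M + 1 : ℕ) : ℤ))).eval (y j)
        = c * ∏ i ∈ Finset.univ.erase j, (y j - y i) := by
      rw [hc, derivative_C_mul, eval_mul, eval_C,
        Lagrange.eval_nodal_derivative_eval_node_eq (Finset.mem_univ j), Lagrange.eval_nodal]
    have hU := Chebyshev.U_real_cos (angle M j) (M : ℤ)
    have hs1 := abs_sin_nat_mul_angle M j
    have hd2 := Chebyshev.T_derivative_eq_U (R := ℝ) ((M + 1 : ℕ) : ℤ)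
    rw [hd2] at hd
    have e : ((M + 1 : ℕ) : ℤ) - 1 = M := by push_cast; ring
    rw [e, eval_mul] at hd
    rw [← hd]
    have hU2 : |eval (y j) (Chebyshev.U ℝ M)| * |Real.sin (angle M j)| = 1 := by
      rw [← abs_mul, hU]; simpa using hs1
    have h3 : 1 ≤ |eval (y j) (Chebyshev.U ℝ M)| := by
      nlinarith [Real.abs_sin_le_one (angle M j), abs_nonneg (eval (y j) (Chebyshev.U ℝ M))]
    have h4 : eval (y j) (((M + 1 : ℕ) : ℤ) : ℝ[X]) = n := by simp [hn]
    rw [h4, abs_mul, abs_of_nonneg (by linarith : 0 ≤ n)]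
    nlinarith
  have hc0 : c ≠ 0 := by
    rintro rfl
    simp at hden; linarith
  have key : (∏ i ∈ Finset.univ.erase j, (s - y i) * (y j - y i)⁻¹)
      = (c * ∏ i ∈ Finset.univ.erase j, (s - y i)) /
        (c * ∏ i ∈ Finset.univ.erase j, (y j - y i)) := by
    rw [mul_div_mul_left _ _ hc0, Finset.prod_mul_distrib, Finset.prod_inv_distrib, div_eq_mul_inv]
  rw [key, abs_div, div_le_iff₀ (by linarith)]
  have : (M : ℝ) + 1 = n := by rw [hn]; push_cast; rfl
  rw [this]
  nlinarith

/-- The value at `t` of the `j`-th Lagrange basis polynomial at the rescaled Chebyshev points. -/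
noncomputable def basisValue (μ ν : ℝ) (M : ℕ) (j : Fin (M + 1)) (t : ℝ) : ℝ :=
  ∏ i ∈ Finset.univ.erase j, (t - node μ ν M i) * (node μ ν M j - node μ ν M i)⁻¹

/-- Lagrange basis polynomials are invariant under affine changes of variable, which reduces to
`[-1, 1]`. -/
theorem abs_basisValue_le {μ ν : ℝ} (hμν : μ < ν) (M : ℕ) (j : Fin (M + 1)) {t : ℝ}
    (ht : t ∈ Set.Icc μ ν) : |basisValue μ ν M j t| ≤ M + 1 := by
  set r := (ν - μ) / 2 with hr
  have hr0 : 0 < r := by linarith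
  set s := (t - (ν + μ) / 2) / r with hs
  have hts : t = (ν + μ) / 2 + r * s := by rw [hs]; field_simp; ring
  have hsm : s ∈ Set.Icc (-1) 1 := by
    rw [hs]
    constructor
    · rw [le_div_iff₀ hr0]; linarith [ht.1]
    · rw [div_le_iff₀ hr0]; linarith [ht.2]
  convert abs_lagrange_cos_angle_le M j hsm using 2
  refine Finset.prod_congr rfl fun i _ => ?_
  rw [node_eq, node_eq, ← hr, hts, add_sub_add_left_eq_sub, add_sub_add_left_eq_sub, ← mul_sub,
    ← mul_sub, mul_inv]
  field_simp

open Polynomial in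
theorem sum_node_pow_mul_basisValue {μ ν : ℝ} (hμν : μ < ν) {M a : ℕ} (ha : a ≤ M) (t : ℝ) :
    ∑ j, node μ ν M j ^ a * basisValue μ ν M j t = t ^ a := by
  have h := Lagrange.eq_interpolate (f := (X : ℝ[X]) ^ a) (s := Finset.univ) (v := node μ ν M)
    (node_injective hμν M).injOn (by rw [degree_X_pow]; simp; exact_mod_cast Nat.lt_succ_of_le ha)
  have h2 := congrArg (eval t) h
  rw [Lagrange.interpolate_apply, eval_finsetSum] at h2
  simp only [eval_pow, eval_X, eval_mul, eval_C, Lagrange.basis, eval_prod,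
    Lagrange.basisDivisor, eval_sub] at h2
  rw [h2]
  refine Finset.sum_congr rfl fun j _ => ?_
  rw [basisValue]
  congr 1
  exact Finset.prod_congr rfl fun i _ => mul_comm _ _

/-! ### Tensor-product interpolation and approximate inverses -/

section Multivariate

variable {𝕜 : Type*} [RCLike 𝕜] {d : ℕ}

theorem evalReal_lagrangeBasis (μ ν : Fin d → ℝ) (M : ℕ) (j : Fin d → Fin (M + 1))
    (t : Fin d → ℝ) : evalReal (lagrangeBasis 𝕜 μ ν M j) t
      = ((∏ k, basisValue (μ k) (ν k) M (j k) (t k) : ℝ) : 𝕜) := by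
  simp [evalReal, lagrangeBasis, basisValue, map_prod]

theorem evalReal_interpolant (h : MvPolynomial (Fin d) 𝕜) (μ ν : Fin d → ℝ) (M : ℕ)
    (t : Fin d → ℝ) : evalReal (interpolant h μ ν M) t = ∑ j : Fin d → Fin (M + 1),
      1 / evalReal h (point μ ν M j) *
        ((∏ k, basisValue (μ k) (ν k) M (j k) (t k) : ℝ) : 𝕜) := by
  simp_rw [← evalReal_lagrangeBasis]
  simp [evalReal, interpolant]

theorem evalReal_eq_sum (p : MvPolynomial (Fin d) 𝕜) (t : Fin d → ℝ) :
    evalReal p t = ∑ s ∈ p.support, p.coeff s * ((∏ k, t k ^ s k : ℝ) : 𝕜) := by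
  rw [evalReal, MvPolynomial.eval_eq']
  simp

/-- Tensor-product Chebyshev interpolation reproduces polynomials of low degree. -/
theorem sum_evalReal_point_mul_basisValue {μ ν : Fin d → ℝ} (hμν : ∀ k, μ k < ν k) {M : ℕ}
    (p : MvPolynomial (Fin d) 𝕜) (hp : p.totalDegree ≤ M) (t : Fin d → ℝ) :
    ∑ j : Fin d → Fin (M + 1), evalReal p (point μ ν M j) *
      ((∏ k, basisValue (μ k) (ν k) M (j k) (t k) : ℝ) : 𝕜) = evalReal p t := by
  simp_rw [evalReal_eq_sum, Finset.sum_mul]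
  rw [Finset.sum_comm]
  refine Finset.sum_congr rfl fun s hs => ?_
  have hle (k : Fin d) : s k ≤ M := by
    refine le_trans ?_ ((MvPolynomial.le_totalDegree hs).trans hp)
    rw [Finsupp.sum_fintype _ _ (fun _ => rfl)]
    exact Finset.single_le_sum (f := fun i => s i) (fun _ _ => Nat.zero_le _) (Finset.mem_univ k)
  simp_rw [mul_assoc, ← Finset.mul_sum, ← RCLike.ofReal_mul, ← RCLike.ofReal_sum,
    ← Finset.prod_mul_distrib]
  congr 2
  -- For a monomial, the sum over multi-indices factors into one-variable sums.
  rw [← Finset.prod_congr rfl fun k _ => sum_node_pow_mul_basisValue (hμν k) (hle k) (t k),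
    Fintype.prod_sum]
  rfl

theorem abs_prod_basisValue_le {μ ν : Fin d → ℝ} (hμν : ∀ k, μ k < ν k) (M : ℕ)
    (j : Fin d → Fin (M + 1)) {t : Fin d → ℝ} (ht : t ∈ Set.Icc μ ν) :
    |∏ k, basisValue (μ k) (ν k) M (j k) (t k)| ≤ ((M : ℝ) + 1) ^ d := by
  rw [Finset.abs_prod]
  refine (Finset.prod_le_prod (fun _ _ => abs_nonneg _) fun k _ =>
    abs_basisValue_le (hμν k) M (j k) ⟨ht.1 k, ht.2 k⟩).trans ?_
  simp

theorem point_mem_Icc {μ ν : Fin d → ℝ} (hμν : ∀ k, μ k < ν k) (M : ℕ)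
    (j : Fin d → Fin (M + 1)) : point μ ν M j ∈ Set.Icc μ ν :=
  ⟨fun k => (node_mem_Icc (hμν k) M (j k)).1, fun k => (node_mem_Icc (hμν k) M (j k)).2⟩

theorem continuous_evalReal (p : MvPolynomial (Fin d) 𝕜) : Continuous (evalReal p) := by
  simp only [funext (evalReal_eq_sum p)]
  have (s : Fin d →₀ ℕ) : Continuous fun t : Fin d → ℝ => ((∏ k, t k ^ s k : ℝ) : 𝕜) :=
    RCLike.continuous_ofReal.comp (by fun_prop)
  fun_prop

/-- The interpolation error is controlled by the error of any approximate inverse of low degree. -/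
theorem norm_one_sub_mul_interpolant_le {μ ν : Fin d → ℝ} (hμν : ∀ k, μ k < ν k)
    {h : MvPolynomial (Fin d) 𝕜} {m B ε : ℝ} (hm : 0 < m)
    (hlow : ∀ t ∈ Set.Icc μ ν, m ≤ ‖evalReal h t‖) (hup : ∀ t ∈ Set.Icc μ ν, ‖evalReal h t‖ ≤ B)
    {M : ℕ} {p : MvPolynomial (Fin d) 𝕜} (hp : p.totalDegree ≤ M)
    (happ : ∀ t ∈ Set.Icc μ ν, ‖1 - evalReal h t * evalReal p t‖ ≤ ε)
    {t : Fin d → ℝ} (ht : t ∈ Set.Icc μ ν) :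
    ‖1 - evalReal h t * evalReal (interpolant h μ ν M) t‖
      ≤ (1 + B / m) * ((M : ℝ) + 1) ^ (2 * d) * ε := by
  have hε : 0 ≤ ε := (norm_nonneg _).trans (happ t ht)
  have hB : 0 ≤ B := (norm_nonneg _).trans (hup t ht)
  have hdiff : evalReal p t - evalReal (interpolant h μ ν M) t
      = ∑ j : Fin d → Fin (M + 1),
        (evalReal p (point μ ν M j) - 1 / evalReal h (point μ ν M j)) *
        ((∏ k, basisValue (μ k) (ν k) M (j k) (t k) : ℝ) : 𝕜) := by
    simp_rw [sub_mul, Finset.sum_sub_distrib]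
    rw [sum_evalReal_point_mul_basisValue hμν p hp, evalReal_interpolant]
  have hterm (j : Fin d → Fin (M + 1)) :
      ‖(evalReal p (point μ ν M j) - 1 / evalReal h (point μ ν M j)) *
        ((∏ k, basisValue (μ k) (ν k) M (j k) (t k) : ℝ) : 𝕜)‖ ≤ ε / m * ((M : ℝ) + 1) ^ d := by
    have hx := point_mem_Icc hμν M j
    have hl := hlow _ hx
    have h0 : evalReal h (point μ ν M j) ≠ 0 := norm_pos_iff.1 (hm.trans_le hl)
    have e : evalReal p (point μ ν M j) - 1 / evalReal h (point μ ν M j)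
        = -((1 - evalReal h (point μ ν M j) * evalReal p (point μ ν M j)) /
          evalReal h (point μ ν M j)) := by
      field_simp
      ring
    rw [norm_mul, e, norm_neg, norm_div, RCLike.norm_ofReal]
    gcongr
    · exact happ _ hx
    · exact abs_prod_basisValue_le hμν M j ht
  -- One factor `(M + 1) ^ d` bounds the basis, the other counts the nodes.
  have hsum : ‖evalReal p t - evalReal (interpolant h μ ν M) t‖
      ≤ ε / m * ((M : ℝ) + 1) ^ (2 * d) := by
    rw [hdiff]
    refine (norm_sum_le_of_le _ fun j _ => hterm j).trans_eq ?_
    simp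
    ring
  have hone : (1 : ℝ) ≤ ((M : ℝ) + 1) ^ (2 * d) := one_le_pow₀ (by simp)
  calc ‖1 - evalReal h t * evalReal (interpolant h μ ν M) t‖
      = ‖(1 - evalReal h t * evalReal p t)
        + evalReal h t * (evalReal p t - evalReal (interpolant h μ ν M) t)‖ := by
        congr 1; ring
    _ ≤ ε + B * (ε / m * ((M : ℝ) + 1) ^ (2 * d)) := by
        refine (norm_add_le _ _).trans (add_le_add (happ t ht) ?_)
        rw [norm_mul]
        gcongr
        exact hup t ht
    _ ≤ ε * ((M : ℝ) + 1) ^ (2 * d) + B * (ε / m * ((M : ℝ) + 1) ^ (2 * d)) := by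
        gcongr
        exact le_mul_of_one_le_right hε hone
    _ = (1 + B / m) * ((M : ℝ) + 1) ^ (2 * d) * ε := by ring

open MvPolynomial in
/-- Truncation of the geometric series for `1 / h = conj h / |h|²`. -/
noncomputable def geomInverse (h : MvPolynomial (Fin d) 𝕜) (c : ℝ) (N : ℕ) :
    MvPolynomial (Fin d) 𝕜 :=
  C (c : 𝕜) * map (starRingEnd 𝕜) h *
    ∑ n ∈ Finset.range N, (1 - C (c : 𝕜) * (h * map (starRingEnd 𝕜) h)) ^ n

/-- Conjugation fixes the real point `t`; this makes `|h|²` a polynomial on the box. -/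
theorem evalReal_map_conj (h : MvPolynomial (Fin d) 𝕜) (t : Fin d → ℝ) :
    evalReal (MvPolynomial.map (starRingEnd 𝕜) h) t = starRingEnd 𝕜 (evalReal h t) := by
  rw [evalReal, evalReal, MvPolynomial.eval_map, MvPolynomial.eval₂_eq', MvPolynomial.eval_eq']
  simp

theorem one_sub_evalReal_mul_geomInverse (h : MvPolynomial (Fin d) 𝕜) (c : ℝ) (N : ℕ)
    (t : Fin d → ℝ) : 1 - evalReal h t * evalReal (geomInverse h c N) t
      = (((1 - c * ‖evalReal h t‖ ^ 2) ^ N : ℝ) : 𝕜) := by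
  have e : evalReal (geomInverse h c N) t = (c : 𝕜) * starRingEnd 𝕜 (evalReal h t) *
      ∑ n ∈ Finset.range N, (1 - (c : 𝕜) * (evalReal h t * starRingEnd 𝕜 (evalReal h t))) ^ n := by
    rw [← evalReal_map_conj]
    simp [evalReal, geomInverse]
  have g := mul_neg_geom_sum
    (1 - (c : 𝕜) * (evalReal h t * starRingEnd 𝕜 (evalReal h t))) N
  rw [sub_sub_cancel] at g
  rw [e]
  push_cast
  rw [← RCLike.mul_conj, sub_eq_iff_eq_add, ← sub_eq_iff_eq_add', ← g]
  ring

open MvPolynomial in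
theorem totalDegree_geomInverse_le (h : MvPolynomial (Fin d) 𝕜) (c : ℝ) (N : ℕ) :
    (geomInverse h c N).totalDegree ≤ 2 * h.totalDegree * N := by
  -- The top exponent `N - 1` truncates at `N = 0`, where the polynomial is zero.
  rcases N.eq_zero_or_pos with rfl | hN
  · simp [geomInverse]
  have hc : (map (starRingEnd 𝕜) h).totalDegree ≤ h.totalDegree :=
    Finset.sup_mono (support_map_subset _ _)
  have hC (p : MvPolynomial (Fin d) 𝕜) : (C (c : 𝕜) * p).totalDegree ≤ p.totalDegree := by
    simpa using totalDegree_mul (C (c : 𝕜)) p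
  have hq : (1 - C (c : 𝕜) * (h * map (starRingEnd 𝕜) h)).totalDegree ≤ 2 * h.totalDegree := by
    refine (totalDegree_sub _ _).trans ?_
    rw [totalDegree_one, Nat.zero_max]
    refine (hC _).trans ((totalDegree_mul _ _).trans ?_)
    omega
  have hs : (∑ n ∈ Finset.range N,
      (1 - C (c : 𝕜) * (h * map (starRingEnd 𝕜) h)) ^ n).totalDegree
      ≤ (N - 1) * (2 * h.totalDegree) := by
    refine totalDegree_finsetSum_le fun n hn => (totalDegree_pow _ _).trans ?_
    have := Finset.mem_range.1 hn
    exact Nat.mul_le_mul (by omega) hq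
  refine (totalDegree_mul _ _).trans ?_
  have := (hC (map (starRingEnd 𝕜) h)).trans hc
  obtain ⟨n, rfl⟩ := Nat.exists_eq_succ_of_ne_zero hN.ne'
  rw [Nat.succ_sub_one] at hs
  nlinarith

end Multivariate

/-- Polynomial factors are absorbed by geometric decay along a subsequence of exponents. -/
theorem exists_pow_mul_pow_div_le (e E : ℕ) (hE : 0 < E) {q : ℝ} (hq0 : 0 < q) (hq1 : q < 1) :
    ∃ D r : ℝ, 0 < D ∧ 0 < r ∧ r < 1 ∧ ∀ M : ℕ, ((M : ℝ) + 1) ^ e * q ^ (M / E) ≤ D * r ^ M := by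
  -- Since `q = s ^ (2 * E)`, the decay is about `s ^ M * s ^ M`: one factor absorbs the polynomial,
  -- the other is the rate.
  set s : ℝ := q ^ ((2 * E : ℝ)⁻¹) with hs
  have hE' : (0 : ℝ) < 2 * E := by positivity
  have hs0 : 0 < s := Real.rpow_pos_of_pos hq0 _
  have hs1 : s < 1 := Real.rpow_lt_one hq0.le hq1 (by positivity)
  have hsq : (s ^ 2) ^ E = q := by
    rw [← pow_mul, ← Real.rpow_natCast, hs, ← Real.rpow_mul hq0.le]
    push_cast
    rw [inv_mul_cancel₀ hE'.ne', Real.rpow_one]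
  have hlim := tendsto_pow_const_mul_const_pow_of_abs_lt_one e
    (show |s| < 1 by rwa [abs_of_pos hs0])
  obtain ⟨K, hK⟩ := hlim.bddAbove_range
  have hK' (M : ℕ) : ((M : ℝ) + 1) ^ e * s ^ (M + 1) ≤ K := by
    simpa using hK (Set.mem_range_self (M + 1))
  have hKpos : 0 < K := lt_of_lt_of_le (by positivity) (hK' 0)
  refine ⟨K / s / q, s, by positivity, hs0, hs1, fun M => ?_⟩
  -- The extra `q` pays for rounding down in `M / E`.
  have h1 : q ^ (M / E) * q ≤ s ^ M * s ^ M := by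
    rw [← pow_succ, ← hsq, ← pow_mul, ← pow_mul, ← pow_add]
    refine pow_le_pow_of_le_one hs0.le hs1.le ?_
    have := Nat.lt_mul_div_succ M hE
    omega
  rw [div_mul_eq_mul_div, le_div_iff₀ hq0, div_mul_eq_mul_div, le_div_iff₀ hs0]
  calc ((M : ℝ) + 1) ^ e * q ^ (M / E) * q * s
      = ((M : ℝ) + 1) ^ e * (q ^ (M / E) * q) * s := by ring
    _ ≤ ((M : ℝ) + 1) ^ e * (s ^ M * s ^ M) * s := by gcongr
    _ = ((M : ℝ) + 1) ^ e * s ^ (M + 1) * s ^ M := by ring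
    _ ≤ K * s ^ M := by gcongr; exact hK' M

end ChebyshevInterpolation

open ChebyshevInterpolation in
theorem mainTheorem2 {𝕜 : Type*} [RCLike 𝕜] {d : ℕ} (μ ν : Fin d → ℝ) (hμν : ∀ k, μ k < ν k)
    (h : MvPolynomial (Fin d) 𝕜)
    (hne : ∀ t ∈ Set.Icc μ ν, ChebyshevInterpolation.evalReal h t ≠ 0) :
    ∃ D₁ r₁ : ℝ, 0 < D₁ ∧ 0 < r₁ ∧ r₁ < 1 ∧
      ∀ M : ℕ, BddAbove (ChebyshevInterpolation.errorSet h μ ν M) ∧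
        ChebyshevInterpolation.uniformError h μ ν M ≤ D₁ * r₁ ^ M := by
  have hcont : ContinuousOn (fun t => ‖evalReal h t‖) (Set.Icc μ ν) :=
    (continuous_evalReal h).norm.continuousOn
  have hnonempty : (Set.Icc μ ν).Nonempty := Set.nonempty_Icc.2 fun k => (hμν k).le
  obtain ⟨a, ha, hmin⟩ := isCompact_Icc.exists_isMinOn hnonempty hcont
  obtain ⟨b, hb, hmax⟩ := isCompact_Icc.exists_isMaxOn hnonempty hcont
  set m := ‖evalReal h a‖ with hm_def
  set B := ‖evalReal h b‖ with hB_def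
  have hm : 0 < m := norm_pos_iff.2 (hne a ha)
  have hlow : ∀ t ∈ Set.Icc μ ν, m ≤ ‖evalReal h t‖ := fun t ht => hmin ht
  have hup : ∀ t ∈ Set.Icc μ ν, ‖evalReal h t‖ ≤ B := fun t ht => hmax ht
  have hmB : m ≤ B := hlow b hb
  have hB : 0 < B := hm.trans_le hmB
  -- This `c` gives `c|h|² ≤ 1/2` on the box, so the ratio stays positive and at most `q`.
  set c : ℝ := (2 * B ^ 2)⁻¹ with hc
  set q : ℝ := 1 - c * m ^ 2 with hq
  have hc0 : 0 < c := by positivity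
  have hcB : c * B ^ 2 = 1 / 2 := by rw [hc]; field_simp
  have hq0 : 0 < q := by
    have : c * m ^ 2 ≤ c * B ^ 2 := by gcongr
    linarith
  have hq1 : q < 1 := by
    have : 0 < c * m ^ 2 := by positivity
    linarith
  -- Each term of the series costs degree at most `2 * h.totalDegree`; the `+ 1` keeps `E` positive
  -- for constant `h`.
  set E := 2 * h.totalDegree + 1 with hE
  obtain ⟨D, r, hD, hr0, hr1, hDr⟩ :=
    exists_pow_mul_pow_div_le (2 * d) E (Nat.succ_pos _) hq0 hq1
  refine ⟨(1 + B / m) * D, r, by positivity, hr0, hr1, fun M => ?_⟩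
  have hbound : ∀ x ∈ errorSet h μ ν M, x ≤ (1 + B / m) * D * r ^ M := by
    rintro _ ⟨t, ht, rfl⟩
    have hdeg : (geomInverse h c (M / E)).totalDegree ≤ M := by
      refine (totalDegree_geomInverse_le h c _).trans (le_trans ?_ (Nat.mul_div_le M E))
      exact Nat.mul_le_mul_right _ (Nat.le_succ _)
    refine (norm_one_sub_mul_interpolant_le hμν hm hlow hup hdeg (ε := q ^ (M / E)) ?_ ht).trans ?_
    · intro u hu
      have h1 : c * m ^ 2 ≤ c * ‖evalReal h u‖ ^ 2 := by gcongr; exact hlow u hu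
      have h2 : c * ‖evalReal h u‖ ^ 2 ≤ c * B ^ 2 := by gcongr; exact hup u hu
      have h3 : 0 ≤ 1 - c * ‖evalReal h u‖ ^ 2 := by linarith
      rw [one_sub_evalReal_mul_geomInverse, RCLike.norm_ofReal, abs_of_nonneg (pow_nonneg h3 _)]
      exact pow_le_pow_left₀ h3 (by linarith) _
    · rw [mul_assoc, mul_assoc]
      exact mul_le_mul_of_nonneg_left (hDr M) (by positivity)
  exact ⟨⟨_, hbound⟩, csSup_le (hnonempty.image _) hbound⟩
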